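/- Let $n\ge 1$, let $M=(m_1,\dots,m_n)$ be a vector of positive integers and let $P(z,\bar z)=\sum\alpha_{JK}z^J\bar z^K$ be a real-valued polynomial on $\mathbb C^n$ which is weighted homogeneous of weight $M$ and degree $d$, that is, $M\cdot J+M\cdot K=d$ whenever $\alpha_{JK}\ne0$, where $M\cdot J=\sum_i m_ij_i$. Let $k_0$ be the largest integer $k$ with $\frac d2\le k\le d-1$ for which there are $J,K$ with $M\cdot K=k$ and $\alpha_{JK}\neq 0$, and assume that $d-k_0\le M\cdot J\le k_0$ whenever $\alpha_{JK}\ne0$ (so $P$ has no pluriharmonic terms). Let $$S_P=\{(z,w)\in\mathbb C^n\times\mathbb C:\ -\operatorname{Re}w+P(z,\bar z)=0\},\qquad \Sigma_P=\{(z,w)\in S_P:\ \det\big(P_{z_i\bar z_j}(z,\bar z)\big)_{i,j}=0\}$$ be the model hypersurface and the set of its Levi-degenerate points. Assume that $S_P$ is generically Levi-nondegenerate, i.e. $S_P\setminus\Sigma_P$ is dense in $S_P$, and that $\Sigma_P$ has no branches of dimension $2n$ near $0$, i.e. some neighbourhood of $0$ contains no point near which $\Sigma_P$ is a real-analytic submanifold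 of dimension $2n$ (equivalently, the projection $\{z:\det P_{z_i\bar z_j}(z,\bar z)=0\}\subset\mathbb C^n$ of $\Sigma_P$ has no branches of dimension $2n-1$ near $0$). For $v\in\mathbb C^n$ put $h^v(\zeta)=((1-\zeta)^{m_1}v_1,\dots,(1-\zeta)^{m_n}v_n)$, and let $Q^v_{i\bar j}$ be the holomorphic polynomials determined by $$\zeta^{k_0}P_{z_i\bar z_j}\big(h^v(\zeta),\overline{h^v(\zeta)}\big)=(1-\zeta)^{d-m_i-m_j}\,Q^v_{i\bar j}(\zeta),\qquad |\zeta|=1 .$$ Then there exists an admissible vector for $P$. More precisely, there is $v\in\mathbb C^n$ such that $Q^v(\zeta)=\det\big(Q^v_{i\bar j}(\zeta)\big)_{i,j}\ne0$ for all $\zeta$ with $|\zeta|=1$ and such that, for every integer $k\ge0$ and every $0<\alpha<1$, there is a function $g^v$, continuous on the closed unit disc $\overline\Delta$, holomorphic on $\Delta$ and with boundary values of class $\mathcal C^{k,\alpha}$ on the unit circle, for which the disc $f^v=(h^v,g^v)$ satisfies $f^v(\partial\Delta)\subset S_P$ but $f^v(\Delta)\not\subset S_P$. -/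

import Mathlib

open scoped ComplexConjugate NNReal Topology ContDiff

namespace LeviModel

/-- Polynomials in `z_1, …, z_n` (variables `Sum.inl i`) and `z̄_1, …, z̄_n` (variables `Sum.inr i`).
The coefficient `α_{JK}` of `z^J z̄^K` is the coefficient at the exponent `s` with
`s (Sum.inl i) = J i` and `s (Sum.inr i) = K i`. -/
abbrev ConjPoly (n : ℕ) := MvPolynomial (Fin n ⊕ Fin n) ℂ

variable {n : ℕ}

/-- The value `P(z, z̄)`. -/
noncomputable def evalConj (P : ConjPoly n) (z : Fin n → ℂ) : ℂ :=
  MvPolynomial.eval (Sum.elim z fun i => conj (z i)) P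

/-- `M · J` for the exponent `s = (J, K)`. -/
def holWeight (M : Fin n → ℕ) (s : Fin n ⊕ Fin n →₀ ℕ) : ℕ := ∑ i, M i * s (Sum.inl i)

/-- `M · K` for the exponent `s = (J, K)`. -/
def antiWeight (M : Fin n → ℕ) (s : Fin n ⊕ Fin n →₀ ℕ) : ℕ := ∑ i, M i * s (Sum.inr i)

/-- `P` is a real-valued weighted homogeneous polynomial of weight `M` and degree `d`,
`k₀` is the largest `k` with `d / 2 ≤ k ≤ d - 1` for which some `α_{JK} ≠ 0` has `M · K = k`,
and every monomial of `P` satisfies `d - k₀ ≤ M · J ≤ k₀`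
(in particular `P` has no purely holomorphic or purely antiholomorphic terms). -/
structure IsModelPolynomial (M : Fin n → ℕ) (d k₀ : ℕ) (P : ConjPoly n) : Prop where
  weight_pos : ∀ i, 0 < M i
  homogeneous : MvPolynomial.IsWeightedHomogeneous (Sum.elim M M) P d
  real_valued : ∀ z : Fin n → ℂ, (evalConj P z).im = 0
  isGreatest : IsGreatest
    {k : ℕ | d ≤ 2 * k ∧ k + 1 ≤ d ∧ ∃ s ∈ P.support, antiWeight M s = k} k₀
  range : ∀ s ∈ P.support, d ≤ holWeight M s + k₀ ∧ holWeight M s ≤ k₀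

/-- The mixed second derivative `∂²P / ∂z_i ∂z̄_j`. -/
noncomputable def leviEntry (P : ConjPoly n) (i j : Fin n) : ConjPoly n :=
  MvPolynomial.pderiv (Sum.inr j) (MvPolynomial.pderiv (Sum.inl i) P)

/-- The Levi matrix `(P_{z_i z̄_j}(z, z̄))_{i,j}`. -/
noncomputable def leviMatrix (P : ConjPoly n) (z : Fin n → ℂ) : Matrix (Fin n) (Fin n) ℂ :=
  Matrix.of fun i j => evalConj (leviEntry P i j) z

/-- The model hypersurface `S_P = {(z, w) : - Re w + P(z, z̄) = 0}` in `ℂⁿ × ℂ`. -/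
def modelHypersurface (P : ConjPoly n) : Set ((Fin n → ℂ) × ℂ) :=
  {p | -p.2.re + (evalConj P p.1).re = 0}

/-- The set `Σ_P` of Levi-degenerate points of `S_P`. -/
def leviDegenerateSet (P : ConjPoly n) : Set ((Fin n → ℂ) × ℂ) :=
  {p | p ∈ modelHypersurface P ∧ (leviMatrix P p.1).det = 0}

/-- `S_P` is generically Levi-nondegenerate: its Levi-nondegenerate points (which form a relatively
open set) are dense in `S_P`. -/
def GenericallyLeviNondegenerate (P : ConjPoly n) : Prop :=
  modelHypersurface P ⊆ closure (modelHypersurface P \ leviDegenerateSet P)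

/-- `p` is a regular point of dimension `k` of the set `A`: near `p`, the set `A` is a
`k`-dimensional real-analytic submanifold, the zero set of an analytic submersion. -/
def IsRegularPointOfDim {E : Type*} [NormedAddCommGroup E] [NormedSpace ℝ E]
    (k : ℕ) (A : Set E) (p : E) : Prop :=
  p ∈ A ∧ ∃ (c : ℕ) (g : E → Fin c → ℝ) (U : Set E), U ∈ 𝓝 p ∧ AnalyticOnNhd ℝ g U ∧
    Function.Surjective (fderiv ℝ g p) ∧
    Module.finrank ℝ (LinearMap.ker (fderiv ℝ g p : E →ₗ[ℝ] Fin c → ℝ)) = k ∧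
    ∀ x ∈ U, x ∈ A ↔ g x = 0

/-- The real-analytic set `A` has a branch of dimension `k` near `x`: there are regular points of
dimension `k` of `A` arbitrarily close to `x`. (When `k` is the largest dimension that `A` can have
near `x`, as for `k = 2n` and a Levi-degenerate set without interior in the hypersurface, this says
that the germ of `A` at `x` has an irreducible component of dimension `k`.) -/
def HasBranchOfDimNear {E : Type*} [NormedAddCommGroup E] [NormedSpace ℝ E]
    (k : ℕ) (A : Set E) (x : E) : Prop :=
  ∀ U ∈ 𝓝 x, ∃ p ∈ U, IsRegularPointOfDim k A p

/-- The disc `h^v(ζ) = ((1 - ζ)^{m_1} v_1, …, (1 - ζ)^{m_n} v_n)`. -/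
def discH (M : Fin n → ℕ) (v : Fin n → ℂ) (ζ : ℂ) : Fin n → ℂ :=
  fun i => (1 - ζ) ^ M i * v i

/-- `g` is continuous on the closed unit disc, holomorphic inside, and its boundary values are of
class `C^{k,α}` on the unit circle (as a function of the angle). -/
def IsHolderDisc (k : ℕ) (α : ℝ≥0) (g : ℂ → ℂ) : Prop :=
  DiffContOnCl ℂ g (Metric.ball 0 1) ∧
  ContDiff ℝ (k : ℕ∞) (fun θ : ℝ => g (circleMap 0 1 θ)) ∧
  ∃ C : ℝ≥0, HolderWith C α (iteratedDeriv k fun θ : ℝ => g (circleMap 0 1 θ))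

/-- `Q = (Q^v_{i j̄})` is the matrix of holomorphic polynomials determined by
`ζ^{k₀} P_{z_i z̄_j}(h^v(ζ), conj h^v(ζ)) = (1 - ζ)^{d - m_i - m_j} Q^v_{i j̄}(ζ)` on `|ζ| = 1`.
(If `d - m_i - m_j < 0` then `P_{z_i z̄_j} = 0`, and the identity says `Q^v_{i j̄} = 0`.) -/
def IsReducedLeviMatrix (M : Fin n → ℕ) (d k₀ : ℕ) (P : ConjPoly n) (v : Fin n → ℂ)
    (Q : Matrix (Fin n) (Fin n) (Polynomial ℂ)) : Prop :=
  ∀ i j, ∀ ζ ∈ Metric.sphere (0 : ℂ) 1,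
    ζ ^ k₀ * leviMatrix P (discH M v ζ) i j =
      (1 - ζ) ^ ((d : ℤ) - M i - M j) * (Q i j).eval ζ

/-- `v` is admissible for `P`: some disc `f^v = (h^v, g^v)` of class `C^{k,α}` is attached to `S_P`
but not contained in `S_P`, and `Q^v = det (Q^v_{i j̄})` has no zero on the unit circle. -/
def IsAdmissible (k : ℕ) (α : ℝ≥0) (M : Fin n → ℕ) (d k₀ : ℕ) (P : ConjPoly n)
    (v : Fin n → ℂ) : Prop :=
  (∃ g : ℂ → ℂ, IsHolderDisc k α g ∧
    (fun ζ => (discH M v ζ, g ζ)) '' Metric.sphere 0 1 ⊆ modelHypersurface P ∧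
    ¬ (fun ζ => (discH M v ζ, g ζ)) '' Metric.ball 0 1 ⊆ modelHypersurface P) ∧
  ∃ Q : Matrix (Fin n) (Fin n) (Polynomial ℂ), IsReducedLeviMatrix M d k₀ P v Q ∧
    ∀ ζ ∈ Metric.sphere (0 : ℂ) 1, Q.det.eval ζ ≠ 0

end LeviModel

/-!
On the unit circle `conj (1 - ζ) = -ζ⁻¹ (1 - ζ)`. Hence, by weighted homogeneity, the value of the
reduced Levi matrix at `ζ` is, up to invertible diagonal factors, the Levi matrix at the point
`(u^{m_1} v_1, …, u^{m_n} v_n)` with `u² = -ζ` (`reduced_det_ne_zero`), and the determinant has no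
zero on the circle as soon as the circle orbit `{(u^{m_i} v_i) : |u| = 1}` of `v` consists of
Levi-nondegenerate points.

Such a `v` exists because a set of real codimension at least two cannot meet all orbits of a
one-dimensional flow. This is proved without dimension theory of real-analytic sets. Let `f` be the
squared modulus of the Levi determinant and `𝒳` the generator of the rotation flow. Every zero of
`f` along an orbit not contained in the zero set has a finite order `μ + 1`. If all orbits through
an open set meet `{f = 0}`, Baire's theorem provides an open set of vectors `v` and a time interval
in which the orbit of `v` has a zero of order exactly `μ + 1` (`exists_orbit_avoiding_zeros`). By
Rolle's theorem this zero is the only zero of `f`, and also the only zero of `𝒳^μ f`, in that time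
interval. So the zero set of `f` is locally the smooth hypersurface `𝒳^μ f = 0`, and it gives a
regular point of dimension `2n` of the Levi-degenerate set
(`isRegularPointOfDim_leviDegenerateSet`). As rotations preserve the norm, this point can be taken
arbitrarily close to the origin, contrary to the assumption on branches.

The function `P ∘ h^v` is a Laurent polynomial on the circle, and therefore equals there the real
part of a polynomial `G`, which serves as the last component of the disc. If the whole disc were
contained in the hypersurface, then `Re G = P ∘ h^v` would hold on an open set and could be
polarized; as `P` has no pluriharmonic terms this forces `P(v) = 0`
(`evalConj_eq_zero_of_re_eq_on_ball`). So `v` is chosen with `P(v) ≠ 0`, an open condition.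
-/

namespace LeviModel

variable {n : ℕ}

/-! ### Polynomials in `z` and `z̄` -/

/-- The weighted dilation `(λ^{m_1} z_1, …, λ^{m_n} z_n)` by a complex number `λ`. -/
def dil (M : Fin n → ℕ) (l : ℂ) (z : Fin n → ℂ) : Fin n → ℂ := fun i => l ^ M i * z i

theorem dil_dil (M : Fin n → ℕ) (a b : ℂ) (z : Fin n → ℂ) :
    dil M a (dil M b z) = dil M (a * b) z := by
  funext i; simp [dil, mul_pow, mul_assoc]

theorem dil_one (M : Fin n → ℕ) (z : Fin n → ℂ) : dil M 1 z = z := by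
  funext i; simp [dil]

theorem norm_dil (M : Fin n → ℕ) {u : ℂ} (hu : ‖u‖ = 1) (z : Fin n → ℂ) : ‖dil M u z‖ = ‖z‖ := by
  simp [dil, Pi.norm_def, nnnorm_mul, nnnorm_pow, show ‖u‖₊ = 1 from NNReal.eq hu]

theorem continuous_dil (M : Fin n → ℕ) :
    Continuous fun x : ℂ × (Fin n → ℂ) => dil M x.1 x.2 := by
  unfold dil; fun_prop

theorem analyticOnNhd_evalConj (p : ConjPoly n) :
    AnalyticOnNhd ℝ (fun z : Fin n → ℂ => evalConj p z) Set.univ := by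
  have h := AnalyticOnNhd.eval_continuousLinearMap' (𝕜 := ℝ) (E := Fin n → ℂ) (Sum.elim
    (fun i => ContinuousLinearMap.proj i)
    (fun i => (Complex.conjCLE : ℂ →L[ℝ] ℂ).comp (ContinuousLinearMap.proj i))) p
  refine h.congr isOpen_univ fun z _ => ?_
  simp only [evalConj]
  congr 2
  funext i
  cases i <;> simp

theorem continuous_evalConj (p : ConjPoly n) : Continuous (evalConj p) :=
  continuous_iff_continuousAt.2 fun z => (analyticOnNhd_evalConj p z trivial).continuousAt

/-- Evaluation at a pair of independent vectors after two independent dilations: each monomial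
`z^J z̄^K` is scaled by `a^{M·J} b^{M·K}`. -/
theorem eval_dil_dil (M : Fin n → ℕ) (p : ConjPoly n) (a b : ℂ) (x y : Fin n → ℂ) :
    MvPolynomial.eval (Sum.elim (dil M a x) (dil M b y)) p =
      ∑ s ∈ p.support, p.coeff s * (a ^ holWeight M s * b ^ antiWeight M s *
        ((∏ i, x i ^ s (Sum.inl i)) * ∏ i, y i ^ s (Sum.inr i))) := by
  rw [MvPolynomial.eval_eq']
  refine Finset.sum_congr rfl fun s _ => ?_
  simp only [Fintype.prod_sum_type, Sum.elim_inl, Sum.elim_inr, dil, mul_pow,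
    Finset.prod_mul_distrib, ← pow_mul, holWeight, antiWeight, Finset.prod_pow_eq_pow_sum]
  ring

theorem evalConj_dil (M : Fin n → ℕ) (p : ConjPoly n) (l : ℂ) (z : Fin n → ℂ) :
    evalConj p (dil M l z) =
      ∑ s ∈ p.support, p.coeff s * (l ^ holWeight M s * conj l ^ antiWeight M s *
        ((∏ i, z i ^ s (Sum.inl i)) * ∏ i, conj (z i) ^ s (Sum.inr i))) := by
  rw [← eval_dil_dil, evalConj]
  congr 2
  funext i
  cases i <;> simp [dil]

/-- A polynomial in `z` and `z̄` vanishing on a ball around the origin is the zero polynomial: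
in the coordinates `z = x + i y`, `z̄ = x - i y` it vanishes on a product of infinite sets. -/
theorem eq_zero_of_evalConj_eq_zero {p : ConjPoly n} {ε : ℝ} (hε : 0 < ε)
    (h : ∀ z ∈ Metric.ball (0 : Fin n → ℂ) ε, evalConj p z = 0) : p = 0 := by
  let q : ConjPoly n := MvPolynomial.bind₁ (Sum.elim
    (fun i => MvPolynomial.X (Sum.inl i) + MvPolynomial.C Complex.I * MvPolynomial.X (Sum.inr i))
    (fun i => MvPolynomial.X (Sum.inl i) - MvPolynomial.C Complex.I * MvPolynomial.X (Sum.inr i))) p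
  have hq : ∀ x : Fin n ⊕ Fin n → ℂ, MvPolynomial.eval x q =
      MvPolynomial.eval (Sum.elim (fun i => x (Sum.inl i) + Complex.I * x (Sum.inr i))
        (fun i => x (Sum.inl i) - Complex.I * x (Sum.inr i))) p := by
    intro x
    simp only [q, ← MvPolynomial.aeval_eq_eval, MvPolynomial.aeval_bind₁]
    congr 2
    funext i
    cases i <;> simp
  have hq0 : q = 0 := by
    refine MvPolynomial.funext_set (fun _ => (fun t : ℝ => (t : ℂ)) '' Set.Ioo 0 (ε / 2))
      (fun _ => (Set.Ioo_infinite (by positivity)).image Complex.ofReal_injective.injOn) ?_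
    intro x hx
    choose t ht htx using fun i => hx i trivial
    rw [map_zero, hq, ← h (fun i => x (Sum.inl i) + Complex.I * x (Sum.inr i))]
    · rw [evalConj]
      congr 2
      funext i
      cases i <;> simp [← htx, sub_eq_add_neg]
    · rw [mem_ball_zero_iff, pi_norm_lt_iff hε]
      intro i
      have h1 := ht (Sum.inl i)
      have h2 := ht (Sum.inr i)
      calc ‖x (Sum.inl i) + Complex.I * x (Sum.inr i)‖
          ≤ ‖x (Sum.inl i)‖ + ‖Complex.I * x (Sum.inr i)‖ := norm_add_le _ _
        _ < ε := by
          simp only [norm_mul, Complex.norm_I, one_mul, ← htx, Complex.norm_real,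
            Real.norm_eq_abs, abs_of_pos h1.1, abs_of_pos h2.1]
          linarith [h1.2, h2.2]
  refine MvPolynomial.funext fun x => ?_
  have := hq (Sum.elim (fun i => (x (Sum.inl i) + x (Sum.inr i)) / 2)
    (fun i => (x (Sum.inl i) - x (Sum.inr i)) / (2 * Complex.I)))
  rw [hq0, map_zero] at this
  rw [map_zero, this]
  congr 2
  funext i
  cases i <;> simp <;> field_simp <;> ring

/-- The complex conjugate of a polynomial in `z` and `z̄`. -/
noncomputable def conjPoly (p : ConjPoly n) : ConjPoly n :=
  MvPolynomial.rename Sum.swap (MvPolynomial.map (starRingEnd ℂ) p)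

theorem evalConj_conjPoly (p : ConjPoly n) (z : Fin n → ℂ) :
    evalConj (conjPoly p) z = conj (evalConj p z) := by
  induction p using MvPolynomial.induction_on with
  | C a => simp [conjPoly, evalConj]
  | add p q hp hq => simp_all [conjPoly, evalConj]
  | mul_X p i hp => cases i <;> simp_all [conjPoly, evalConj]

/-! ### The rotation flow -/

/-- The derivation `𝒳` generating the flow `z ↦ (e^{i m_1 φ} z_1, …, e^{i m_n φ} z_n)`. -/
noncomputable def rotDeriv (M : Fin n → ℕ) : Derivation ℂ (ConjPoly n) (ConjPoly n) :=
  MvPolynomial.mkDerivation ℂ (Sum.elim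
    (fun i => MvPolynomial.C (M i * Complex.I) * MvPolynomial.X (Sum.inl i))
    (fun i => MvPolynomial.C (-(M i * Complex.I)) * MvPolynomial.X (Sum.inr i)))

/-- The rotation by the angle `φ`. -/
noncomputable def rot (M : Fin n → ℕ) (φ : ℝ) (z : Fin n → ℂ) : Fin n → ℂ :=
  dil M (Complex.exp (φ * Complex.I)) z

theorem rot_rot (M : Fin n → ℕ) (φ ψ : ℝ) (z : Fin n → ℂ) :
    rot M φ (rot M ψ z) = rot M (φ + ψ) z := by
  simp [rot, dil_dil, ← Complex.exp_add, add_mul]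

theorem rot_zero (M : Fin n → ℕ) (z : Fin n → ℂ) : rot M 0 z = z := by
  simp [rot, dil_one]

theorem norm_rot (M : Fin n → ℕ) (φ : ℝ) (z : Fin n → ℂ) : ‖rot M φ z‖ = ‖z‖ :=
  norm_dil M (Complex.norm_exp_ofReal_mul_I φ) z

theorem continuous_rot (M : Fin n → ℕ) :
    Continuous fun x : ℝ × (Fin n → ℂ) => rot M x.1 x.2 :=
  (continuous_dil M).comp (f := fun x : ℝ × (Fin n → ℂ) =>
    (Complex.exp (x.1 * Complex.I), x.2)) (by fun_prop)

theorem hasDerivAt_rot_apply (M : Fin n → ℕ) (z : Fin n → ℂ) (φ : ℝ) (i : Fin n) :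
    HasDerivAt (fun t : ℝ => rot M t z i) (M i * Complex.I * rot M φ z i) φ := by
  have h (t : ℝ) : rot M t z i = Complex.exp (t * (M i * Complex.I)) * z i := by
    simp only [rot, dil, ← Complex.exp_nat_mul]
    ring_nf
  simp only [h]
  have := ((((hasDerivAt_id φ).ofReal_comp).mul_const (M i * Complex.I)).cexp).mul_const (z i)
  refine this.congr_deriv ?_
  simp
  ring

theorem analyticAt_rot_apply (M : Fin n → ℕ) (z : Fin n → ℂ) (φ : ℝ) (i : Fin n) :
    AnalyticAt ℝ (fun t : ℝ => rot M t z i) φ := by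
  have h : AnalyticAt ℝ (fun t : ℝ => (t : ℂ)) φ := Complex.ofRealCLM.analyticAt φ
  have h2 : AnalyticAt ℝ (fun t : ℝ => Complex.exp (t * Complex.I)) φ :=
    (Complex.differentiable_exp.analyticAt _ |>.restrictScalars (𝕜 := ℝ)).comp
      (h.mul analyticAt_const)
  exact (h2.pow _).mul analyticAt_const

theorem hasDerivAt_evalConj_rot (M : Fin n → ℕ) (p : ConjPoly n) (z : Fin n → ℂ) (φ : ℝ) :
    HasDerivAt (fun t : ℝ => evalConj p (rot M t z)) (evalConj (rotDeriv M p) (rot M φ z)) φ := by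
  induction p using MvPolynomial.induction_on with
  | C a => simpa [evalConj, rotDeriv] using hasDerivAt_const φ a
  | add p q hp hq => simpa only [evalConj, map_add] using hp.fun_add hq
  | mul_X p i hp =>
    cases i with
    | inl i =>
      have := hp.mul (hasDerivAt_rot_apply M z φ i)
      simp only [evalConj, map_mul, MvPolynomial.eval_X, Derivation.leibniz, rotDeriv,
        MvPolynomial.mkDerivation_X, smul_eq_mul, map_add, Sum.elim_inl,
        MvPolynomial.eval_C] at this ⊢
      refine this.congr_deriv ?_
      ring
    | inr i =>
      have := hp.mul (Complex.conjCLE.toContinuousLinearMap.hasFDerivAt.comp_hasDerivAt φ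
        (hasDerivAt_rot_apply M z φ i))
      simp only [evalConj, map_mul, MvPolynomial.eval_X, Derivation.leibniz, rotDeriv,
        MvPolynomial.mkDerivation_X, smul_eq_mul, map_add, Sum.elim_inr,
        MvPolynomial.eval_C] at this ⊢
      refine this.congr_deriv ?_
      simp
      ring

/-- The `k`-th derivative of `Re p` along the rotation flow, at the point reached from `v` at time
`φ`. -/
noncomputable def flowDeriv (M : Fin n → ℕ) (p : ConjPoly n) (k : ℕ) (φ : ℝ) (v : Fin n → ℂ) : ℝ :=
  (evalConj ((rotDeriv M)^[k] p) (rot M φ v)).re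

theorem flowDeriv_add (M : Fin n → ℕ) (p : ConjPoly n) (k : ℕ) (φ ψ : ℝ) (v : Fin n → ℂ) :
    flowDeriv M p k (φ + ψ) v = flowDeriv M p k φ (rot M ψ v) := by
  simp [flowDeriv, rot_rot]

theorem hasDerivAt_flowDeriv (M : Fin n → ℕ) (p : ConjPoly n) (k : ℕ) (φ : ℝ) (v : Fin n → ℂ) :
    HasDerivAt (fun t => flowDeriv M p k t v) (flowDeriv M p (k + 1) φ v) φ := by
  have := Complex.reCLM.hasFDerivAt.comp_hasDerivAt φ
    (hasDerivAt_evalConj_rot M ((rotDeriv M)^[k] p) v φ)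
  rw [flowDeriv, Function.iterate_succ_apply']
  exact this

theorem continuous_flowDeriv (M : Fin n → ℕ) (p : ConjPoly n) (k : ℕ) :
    Continuous fun x : ℝ × (Fin n → ℂ) => flowDeriv M p k x.1 x.2 :=
  Complex.continuous_re.comp ((continuous_evalConj _).comp (continuous_rot M))

theorem continuous_flowDeriv_time (M : Fin n → ℕ) (p : ConjPoly n) (k : ℕ) (v : Fin n → ℂ) :
    Continuous fun t => flowDeriv M p k t v :=
  continuous_iff_continuousAt.2 fun t => (hasDerivAt_flowDeriv M p k t v).continuousAt

theorem continuous_flowDeriv_point (M : Fin n → ℕ) (p : ConjPoly n) (k : ℕ) (φ : ℝ) :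
    Continuous fun v => flowDeriv M p k φ v := by
  have h := continuous_flowDeriv M p k
  fun_prop

theorem analyticOnNhd_flowDeriv (M : Fin n → ℕ) (p : ConjPoly n) (k : ℕ) (v : Fin n → ℂ) :
    AnalyticOnNhd ℝ (fun t => flowDeriv M p k t v) Set.univ := by
  intro φ _
  refine (Complex.reCLM.analyticAt _).comp ?_
  exact (analyticOnNhd_evalConj ((rotDeriv M)^[k] p) (rot M φ v) trivial).comp
    (f := fun t => rot M t v) (analyticAt_pi_iff.2 fun i => analyticAt_rot_apply M v φ i)

theorem iteratedDeriv_flowDeriv (M : Fin n → ℕ) (p : ConjPoly n) (k j : ℕ) (v : Fin n → ℂ) :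
    iteratedDeriv k (fun t => flowDeriv M p j t v) = fun t => flowDeriv M p (j + k) t v := by
  induction k with
  | zero => simp
  | succ k ih =>
    rw [iteratedDeriv_succ, ih]
    exact funext fun t => (hasDerivAt_flowDeriv M p (j + k) t v).deriv

/-- Along an orbit on which `Re p` does not vanish identically all zeros of `Re p` have finite
order. -/
theorem exists_flowDeriv_ne_zero (M : Fin n → ℕ) (p : ConjPoly n) {v : Fin n → ℂ} {φ ψ : ℝ}
    (h : flowDeriv M p 0 ψ v ≠ 0) : ∃ k, flowDeriv M p k φ v ≠ 0 := by
  by_contra! H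
  have han := analyticOnNhd_flowDeriv M p 0 v
  have htop : analyticOrderAt (fun t => flowDeriv M p 0 t v) φ = ⊤ := by
    refine ENat.eq_top_iff_forall_ge.2 fun m => ?_
    refine (natCast_le_analyticOrderAt_iff_iteratedDeriv_eq_zero (han φ trivial)).2 fun i _ => ?_
    rw [iteratedDeriv_flowDeriv]
    exact H _
  exact h (han.eqOn_zero_of_preconnected_of_eventuallyEq_zero isPreconnected_univ
    (Set.mem_univ φ) (analyticOrderAt_eq_top.1 htop) (Set.mem_univ ψ))

/-! ### Orbits avoiding the zero set -/

/-- A function all of whose derivatives below order `μ + 1` vanish at `c`, while its derivative of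
order `μ + 1` has no zero in `[a, b]`, has `c` as its only zero in `[a, b]`, and so do its
derivatives of order at most `μ`. -/
theorem eq_of_flowDeriv_eq_zero (M : Fin n → ℕ) (p : ConjPoly n) {μ : ℕ} {a b c : ℝ}
    {v : Fin n → ℂ} (hc : c ∈ Set.Icc a b) (hlow : ∀ k ≤ μ, flowDeriv M p k c v = 0)
    (htop : ∀ t ∈ Set.Icc a b, flowDeriv M p (μ + 1) t v ≠ 0) {j : ℕ} (hj : j ≤ μ) {t : ℝ}
    (ht : t ∈ Set.Icc a b) (h0 : flowDeriv M p j t v = 0) : t = c := by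
  -- By Rolle's theorem a second zero of one derivative produces one of the next derivative.
  have rolle (j : ℕ) (t : ℝ) (ht : t ∈ Set.Icc a b) (htc : t ≠ c) (h0 : flowDeriv M p j t v = 0)
      (hc0 : flowDeriv M p j c v = 0) :
      ∃ s ∈ Set.Icc a b, s ≠ c ∧ flowDeriv M p (j + 1) s v = 0 := by
    have hcont := continuous_flowDeriv_time M p j v
    rcases htc.lt_or_gt with h | h
    · obtain ⟨s, hs, hs0⟩ := exists_hasDerivAt_eq_zero
        (f := fun t => flowDeriv M p j t v) (f' := fun t => flowDeriv M p (j + 1) t v) h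
        hcont.continuousOn (h0.trans hc0.symm) fun x _ => hasDerivAt_flowDeriv M p j x v
      exact ⟨s, ⟨ht.1.trans hs.1.le, hs.2.le.trans hc.2⟩, hs.2.ne, hs0⟩
    · obtain ⟨s, hs, hs0⟩ := exists_hasDerivAt_eq_zero
        (f := fun t => flowDeriv M p j t v) (f' := fun t => flowDeriv M p (j + 1) t v) h
        hcont.continuousOn (hc0.trans h0.symm) fun x _ => hasDerivAt_flowDeriv M p j x v
      exact ⟨s, ⟨hc.1.trans hs.1.le, hs.2.le.trans ht.2⟩, hs.1.ne', hs0⟩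
  obtain ⟨i, rfl⟩ := Nat.exists_eq_add_of_le hj
  induction i generalizing j t with
  | zero =>
    by_contra htc
    obtain ⟨s, hs, -, hs0⟩ := rolle j t ht htc h0 (hlow j le_rfl)
    exact htop s hs hs0
  | succ i ih =>
    by_contra htc
    obtain ⟨s, hs, hsc, hs0⟩ := rolle j t ht htc h0 (hlow j hj)
    rw [show j + (i + 1) = j + 1 + i by omega] at hlow htop
    exact hsc (ih hs hs0 hlow htop (by omega))

/-- The closed set of vectors `v` whose orbit has, for some time in `[a, b]`, a zero of order at
least `μ + 1`, while the derivative of order `μ + 1` is at least `1 / (m + 1)` in absolute value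
throughout `[a, b]`. -/
def exactOrderSet (M : Fin n → ℕ) (p : ConjPoly n) (μ m : ℕ) (a b : ℝ) : Set (Fin n → ℂ) :=
  {v | (∀ t ∈ Set.Icc a b, 1 / ((m : ℝ) + 1) ≤ |flowDeriv M p (μ + 1) t v|) ∧
    ∃ t ∈ Set.Icc a b, ∀ k ≤ μ, flowDeriv M p k t v = 0}

theorem isClosed_exactOrderSet (M : Fin n → ℕ) (p : ConjPoly n) (μ m : ℕ) (a b : ℝ) :
    IsClosed (exactOrderSet M p μ m a b) := by
  refine IsClosed.inter
    (s₁ := {v | ∀ t ∈ Set.Icc a b, 1 / ((m : ℝ) + 1) ≤ |flowDeriv M p (μ + 1) t v|})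
    (s₂ := {v | ∃ t ∈ Set.Icc a b, ∀ k ≤ μ, flowDeriv M p k t v = 0}) ?_ ?_
  · simp only [Set.ofPred_forall]
    refine isClosed_iInter fun t => isClosed_iInter fun _ => ?_
    exact isClosed_le continuous_const
      (continuous_flowDeriv_point M p (μ + 1) t).abs
  · have hcl : IsClosed {x : Set.Icc a b × (Fin n → ℂ) |
        ∀ k ≤ μ, flowDeriv M p k x.1 x.2 = 0} := by
      simp only [Set.ofPred_forall]
      refine isClosed_iInter fun k => isClosed_iInter fun _ => ?_
      exact isClosed_eq ((continuous_flowDeriv M p k).comp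
        (f := fun x : Set.Icc a b × (Fin n → ℂ) => ((x.1 : ℝ), x.2)) (by fun_prop))
        continuous_const
    have himg := isClosedMap_snd_of_compactSpace _ hcl
    convert himg using 1
    refine Set.ext fun v => ?_
    simp

/-- Every vector whose orbit meets the zero set of `Re p`, but is not contained in it, lies in one
of countably many sets `exactOrderSet`. -/
theorem exists_mem_exactOrderSet (M : Fin n → ℕ) (p : ConjPoly n) {v : Fin n → ℂ} {φ : ℝ}
    (hv : flowDeriv M p 0 0 v ≠ 0) (hφ : flowDeriv M p 0 φ v = 0) :
    ∃ (μ m : ℕ) (a b : ℚ), v ∈ exactOrderSet M p μ m a b := by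
  classical
  have hex := exists_flowDeriv_ne_zero M p (φ := φ) hv
  obtain ⟨μ, hμ⟩ : ∃ μ, Nat.find hex = μ + 1 := by
    refine Nat.exists_eq_succ_of_ne_zero fun h => ?_
    have := Nat.find_spec hex
    rw [h] at this
    exact this hφ
  have hne : flowDeriv M p (μ + 1) φ v ≠ 0 := hμ ▸ Nat.find_spec hex
  have hlow : ∀ k ≤ μ, flowDeriv M p k φ v = 0 := fun k hk => by
    have := Nat.find_min hex (m := k) (by omega)
    simpa using this
  obtain ⟨m, hm⟩ := exists_nat_one_div_lt (abs_pos.2 hne)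
  have hcont : Continuous fun t => |flowDeriv M p (μ + 1) t v| :=
    (continuous_flowDeriv_time M p (μ + 1) v).abs
  obtain ⟨ε, hε, hball⟩ := Metric.eventually_nhds_iff.1 (hcont.continuousAt.eventually_const_lt hm)
  obtain ⟨a, ha1, ha2⟩ := exists_rat_btwn (show φ - ε < φ by linarith)
  obtain ⟨b, hb1, hb2⟩ := exists_rat_btwn (show φ < φ + ε by linarith)
  refine ⟨μ, m, a, b, fun t ht => (hball ?_).le, φ, ⟨ha2.le, hb1.le⟩, hlow⟩
  rw [Real.dist_eq, abs_lt]
  constructor <;> linarith [ht.1, ht.2]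

/-- The orbit of an interior point of an `exactOrderSet` meets the zero set of `Re p` in a point near
which this set coincides with the hypersurface `Re 𝒳^μ p = 0`, transverse to the flow there. -/
theorem exists_transverse_zero_of_mem_interior (M : Fin n → ℕ) (p : ConjPoly n) {μ m : ℕ} {a b : ℝ}
    {v : Fin n → ℂ} (hv : v ∈ interior (exactOrderSet M p μ m a b)) :
    ∃ φ, flowDeriv M p 0 φ v = 0 ∧ flowDeriv M p μ φ v = 0 ∧ flowDeriv M p (μ + 1) φ v ≠ 0 ∧
      ∀ᶠ z in 𝓝 (rot M φ v), flowDeriv M p 0 0 z = 0 ↔ flowDeriv M p μ 0 z = 0 := by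
  have hne {w : Fin n → ℂ} (hw : w ∈ exactOrderSet M p μ m a b) (t : ℝ) (ht : t ∈ Set.Icc a b) :
      flowDeriv M p (μ + 1) t w ≠ 0 :=
    abs_pos.1 (lt_of_lt_of_le Nat.one_div_pos_of_nat (hw.1 t ht))
  have hvmem := interior_subset hv
  obtain ⟨φ, hφ, hlow⟩ := hvmem.2
  refine ⟨φ, hlow 0 (Nat.zero_le μ), hlow μ le_rfl, hne hvmem φ hφ, ?_⟩
  have hcont : Continuous (rot M (-φ)) := (continuous_rot M).comp (Continuous.prodMk_right (-φ))
  have hev : ∀ᶠ z in 𝓝 (rot M φ v), rot M (-φ) z ∈ exactOrderSet M p μ m a b := by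
    refine hcont.continuousAt.eventually_mem ?_
    rw [rot_rot, neg_add_cancel, rot_zero]
    exact mem_interior_iff_mem_nhds.1 hv
  filter_upwards [hev] with z hz
  have hz' (k : ℕ) : flowDeriv M p k 0 z = flowDeriv M p k φ (rot M (-φ) z) := by
    rw [← flowDeriv_add, add_neg_cancel]
  obtain ⟨c, hc, hclow⟩ := hz.2
  have key {j : ℕ} (hj : j ≤ μ) (h0 : flowDeriv M p j φ (rot M (-φ) z) = 0) : φ = c :=
    eq_of_flowDeriv_eq_zero M p hc hclow (hne hz) hj hφ h0
  rw [hz', hz']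
  constructor
  · intro h
    obtain rfl := key (Nat.zero_le μ) h
    exact hclow μ le_rfl
  · intro h
    obtain rfl := key le_rfl h
    exact hclow 0 (Nat.zero_le μ)

/-- If the zero set of `Re p` is nowhere dense, and no orbit through the open set `O` meets it in a
point where it is a smooth hypersurface transverse to the flow, then some orbit through `O` avoids
the zero set. Otherwise `O` would be covered by countably many closed sets with empty interior. -/
theorem exists_orbit_avoiding_zeros (M : Fin n → ℕ) (p : ConjPoly n) {O : Set (Fin n → ℂ)}
    (hO : IsOpen O) (hne : O.Nonempty) (hdense : Dense {z | flowDeriv M p 0 0 z ≠ 0})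
    (hreg : ∀ v ∈ O, ∀ φ μ, flowDeriv M p 0 φ v = 0 → flowDeriv M p μ φ v = 0 →
      flowDeriv M p (μ + 1) φ v ≠ 0 →
      ¬ ∀ᶠ z in 𝓝 (rot M φ v), flowDeriv M p 0 0 z = 0 ↔ flowDeriv M p μ 0 z = 0) :
    ∃ v ∈ O, ∀ φ, flowDeriv M p 0 φ v ≠ 0 := by
  by_contra! H
  -- The closed cover: the complement of `O`, the zero set itself, and the sets `exactOrderSet`.
  let F : Option (Option (ℕ × ℕ × ℚ × ℚ)) → Set (Fin n → ℂ) := fun i =>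
    i.elim Oᶜ fun j => j.elim {z | flowDeriv M p 0 0 z = 0} fun k =>
      exactOrderSet M p k.1 k.2.1 k.2.2.1 k.2.2.2
  have hF : ∀ i, IsClosed (F i) := by
    rintro (_ | _ | i)
    · exact hO.isClosed_compl
    · exact isClosed_eq (continuous_flowDeriv_point M p 0 0) continuous_const
    · exact isClosed_exactOrderSet M p _ _ _ _
  have hcov : ⋃ i, F i = Set.univ := by
    refine Set.eq_univ_of_forall fun v => Set.mem_iUnion.2 ?_
    by_cases hv : v ∈ O
    · by_cases h0 : flowDeriv M p 0 0 v = 0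
      · exact ⟨some none, h0⟩
      · obtain ⟨φ, hφ⟩ := H v hv
        obtain ⟨μ, m, a, b, h⟩ := exists_mem_exactOrderSet M p h0 hφ
        exact ⟨some (some (μ, m, a, b)), h⟩
    · exact ⟨none, hv⟩
  obtain ⟨v, hvO, hv⟩ := (dense_iUnion_interior_of_closed hF hcov).inter_open_nonempty O hO hne
  obtain ⟨i, hi⟩ := Set.mem_iUnion.1 hv
  rcases i with _ | _ | i
  · exact interior_subset hi hvO
  · obtain ⟨w, hw, hw'⟩ := hdense.inter_open_nonempty _ isOpen_interior ⟨v, hi⟩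
    exact hw' (interior_subset (s := {z | flowDeriv M p 0 0 z = 0}) hw)
  · obtain ⟨φ, h1, h2, h3, h4⟩ := exists_transverse_zero_of_mem_interior M p hi
    exact hreg v hvO φ _ h1 h2 h3 h4

/-! ### Regular points of the Levi-degenerate set -/

/-- The Levi determinant as a polynomial in `z` and `z̄`. -/
noncomputable def leviDet (P : ConjPoly n) : ConjPoly n :=
  (Matrix.of fun i j => leviEntry P i j).det

theorem evalConj_leviDet (P : ConjPoly n) (z : Fin n → ℂ) :
    evalConj (leviDet P) z = (leviMatrix P z).det := by
  rw [leviDet, evalConj, RingHom.map_det]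
  rfl

/-- The squared modulus of the Levi determinant as a polynomial in `z` and `z̄`. -/
noncomputable def leviDetSq (P : ConjPoly n) : ConjPoly n := leviDet P * conjPoly (leviDet P)

theorem flowDeriv_leviDetSq_eq_zero_iff (M : Fin n → ℕ) (P : ConjPoly n) (φ : ℝ) (z : Fin n → ℂ) :
    flowDeriv M (leviDetSq P) 0 φ z = 0 ↔ (leviMatrix P (rot M φ z)).det = 0 := by
  have : evalConj (leviDetSq P) (rot M φ z) =
      (leviMatrix P (rot M φ z)).det * conj (leviMatrix P (rot M φ z)).det := by
    rw [← evalConj_leviDet, ← evalConj_conjPoly]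
    simp only [leviDetSq, evalConj, map_mul]
  rw [flowDeriv, Function.iterate_zero, id, this, Complex.mul_conj, Complex.ofReal_re,
    Complex.normSq_eq_zero]

theorem dense_leviMatrix_det_ne_zero {P : ConjPoly n} (h : GenericallyLeviNondegenerate P) :
    Dense {z | (leviMatrix P z).det ≠ 0} := by
  intro z
  have hz : (z, ((evalConj P z).re : ℂ)) ∈ modelHypersurface P := by simp [modelHypersurface]
  refine map_mem_closure continuous_fst (h hz) fun x hx => ?_
  exact fun h0 => hx.2 ⟨hx.1, h0⟩

/-- A point at which the projection of the Levi-degenerate set is given by a single equation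
`Re q = 0` that is transverse to the flow is a regular point of dimension `2n`. -/
theorem isRegularPointOfDim_leviDegenerateSet (M : Fin n → ℕ) (P q : ConjPoly n) {z : Fin n → ℂ}
    (hz : (leviMatrix P z).det = 0) (hq : flowDeriv M q 1 0 z ≠ 0)
    (hiff : ∀ᶠ x in 𝓝 z, (leviMatrix P x).det = 0 ↔ flowDeriv M q 0 0 x = 0) :
    IsRegularPointOfDim (2 * n) (leviDegenerateSet P) (z, ((evalConj P z).re : ℂ)) := by
  set w : ℂ := ((evalConj P z).re : ℂ)
  let g₁ : (Fin n → ℂ) × ℂ → ℝ := fun x => flowDeriv M q 0 0 x.1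
  let g₂ : (Fin n → ℂ) × ℂ → ℝ := fun x => -x.2.re + (evalConj P x.1).re
  let g : (Fin n → ℂ) × ℂ → Fin 2 → ℝ := fun x => ![g₁ x, g₂ x]
  have hev (r : ConjPoly n) :
      AnalyticOnNhd ℝ (fun x : (Fin n → ℂ) × ℂ => (evalConj r x.1).re) Set.univ := fun x _ =>
    (Complex.reCLM.analyticAt _).comp ((analyticOnNhd_evalConj r x.1 trivial).comp analyticAt_fst)
  have hg₁ : AnalyticOnNhd ℝ g₁ Set.univ := by
    simpa only [g₁, flowDeriv, rot_zero] using! hev q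
  have hg₂ : AnalyticOnNhd ℝ g₂ Set.univ := fun x _ =>
    ((Complex.reCLM.analyticAt _).comp analyticAt_snd).neg.add (hev P x trivial)
  have hg : AnalyticOnNhd ℝ g Set.univ := fun x _ => by
    refine analyticAt_pi_iff.2 fun i => ?_
    fin_cases i
    · exact hg₁ x trivial
    · exact hg₂ x trivial
  have hd₁ := (hg₁ (z, w) trivial).differentiableAt.hasFDerivAt
  have hd₂ := (hg₂ (z, w) trivial).differentiableAt.hasFDerivAt
  have hd : HasFDerivAt g (ContinuousLinearMap.pi ![fderiv ℝ g₁ (z, w), fderiv ℝ g₂ (z, w)])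
      (z, w) := by
    refine hasFDerivAt_pi.2 fun i => ?_
    fin_cases i
    · exact hd₁
    · exact hd₂
  -- The tangent vector of the flow detects the first equation.
  obtain ⟨ξ, hξ⟩ : ∃ ξ, fderiv ℝ g₁ (z, w) ξ ≠ 0 := by
    refine ⟨(fun i => M i * Complex.I * rot M 0 z i, 0), ?_⟩
    have hcurve : HasDerivAt (fun t : ℝ => (rot M t z, w))
        ((fun i => M i * Complex.I * rot M 0 z i), (0 : ℂ)) 0 :=
      (hasDerivAt_pi.2 fun i => hasDerivAt_rot_apply M z 0 i).prodMk (hasDerivAt_const _ _)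
    have hd₁' : HasFDerivAt g₁ (fderiv ℝ g₁ (z, w)) (rot M 0 z, w) := by rwa [rot_zero]
    have h := hd₁'.comp_hasDerivAt (0 : ℝ) hcurve
    have hfl : (g₁ ∘ fun t : ℝ => (rot M t z, w)) = fun t => flowDeriv M q 0 t z := by
      funext t
      simp [g₁, ← flowDeriv_add]
    rw [hfl] at h
    rw [h.unique (hasDerivAt_flowDeriv M q 0 0 z)]
    exact hq
  -- The direction of `w` does not change the first equation and is transverse to the second.
  have hline : HasDerivAt (fun t : ℝ => (z, w + (t : ℂ))) ((0 : Fin n → ℂ), (1 : ℂ)) 0 := by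
    refine (hasDerivAt_const _ _).prodMk ?_
    simpa using (hasDerivAt_id (0 : ℝ)).ofReal_comp.const_add w
  have hd₁' : HasFDerivAt g₁ (fderiv ℝ g₁ (z, w)) (z, w + ((0 : ℝ) : ℂ)) := by simpa using hd₁
  have hd₂' : HasFDerivAt g₂ (fderiv ℝ g₂ (z, w)) (z, w + ((0 : ℝ) : ℂ)) := by simpa using hd₂
  have he₁ : fderiv ℝ g₁ (z, w) (0, 1) = 0 :=
    HasDerivAt.unique (f := fun _ => g₁ (z, w)) (hd₁'.comp_hasDerivAt (0 : ℝ) hline)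
      (hasDerivAt_const _ _)
  have he₂ : fderiv ℝ g₂ (z, w) (0, 1) = -1 := by
    refine (hd₂'.comp_hasDerivAt (0 : ℝ) hline).unique ?_
    have : (g₂ ∘ fun t : ℝ => (z, w + (t : ℂ))) = fun t => -t + (-w.re + (evalConj P z).re) := by
      funext t
      simp [g₂]
      ring
    rw [this]
    exact (hasDerivAt_neg (0 : ℝ)).add_const _
  have hsurj : Function.Surjective (fderiv ℝ g (z, w)) := by
    rw [hd.fderiv]
    intro y
    let s := y 0 / fderiv ℝ g₁ (z, w) ξ
    refine ⟨s • ξ + (s * fderiv ℝ g₂ (z, w) ξ - y 1) • (0, 1), ?_⟩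
    funext i
    fin_cases i
    · simp [-Prod.smul_mk, he₁, s, hξ]
    · simp [-Prod.smul_mk, he₂]
  refine ⟨⟨by simp [modelHypersurface, w], hz⟩, 2, g,
    {x | (leviMatrix P x.1).det = 0 ↔ flowDeriv M q 0 0 x.1 = 0}, ?_,
    hg.mono (Set.subset_univ _), hsurj, ?_, ?_⟩
  · exact (continuousAt_fst (p := (z, w))).eventually hiff
  · have hrank := LinearMap.finrank_range_add_finrank_ker
      (fderiv ℝ g (z, w) : (Fin n → ℂ) × ℂ →ₗ[ℝ] Fin 2 → ℝ)
    rw [LinearMap.range_eq_top.2 hsurj, finrank_top] at hrank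
    simp [Module.finrank_pi_fintype] at hrank
    omega
  · intro x hx
    have : g x = 0 ↔ g₁ x = 0 ∧ g₂ x = 0 := by
      simp [g, funext_iff, Fin.forall_fin_two]
    rw [this]
    exact ⟨fun h => ⟨hx.1 h.2, h.1⟩, fun h => ⟨h.2, hx.2 h.1⟩⟩

/-! ### Weights of the monomials -/

theorem holWeight_add_antiWeight {M : Fin n → ℕ} {d : ℕ} {p : ConjPoly n}
    (h : MvPolynomial.IsWeightedHomogeneous (Sum.elim M M) p d) {s : Fin n ⊕ Fin n →₀ ℕ}
    (hs : s ∈ p.support) : holWeight M s + antiWeight M s = d := by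
  rw [← h (MvPolynomial.mem_support_iff.1 hs), Finsupp.weight_apply,
    Finsupp.sum_fintype _ _ (by simp)]
  simp [holWeight, antiWeight, mul_comm]

theorem weights_of_mem_support_leviEntry {M : Fin n → ℕ} {d k₀ : ℕ} {P : ConjPoly n}
    (hP : IsModelPolynomial M d k₀ P) (i j : Fin n) {s : Fin n ⊕ Fin n →₀ ℕ}
    (hs : s ∈ (leviEntry P i j).support) :
    holWeight M s + antiWeight M s + M i + M j = d ∧ antiWeight M s ≤ k₀ := by
  have hs' : s + Finsupp.single (Sum.inr j) 1 + Finsupp.single (Sum.inl i) 1 ∈ P.support := by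
    rw [MvPolynomial.mem_support_iff, leviEntry, MvPolynomial.coeff_pderiv,
      MvPolynomial.coeff_pderiv] at hs
    exact MvPolynomial.mem_support_iff.2 (left_ne_zero_of_mul (left_ne_zero_of_mul hs))
  have h1 := holWeight_add_antiWeight hP.homogeneous hs'
  have h2 := (hP.range _ hs').1
  have hhol : holWeight M (s + Finsupp.single (Sum.inr j) 1 + Finsupp.single (Sum.inl i) 1) =
      holWeight M s + M i := by
    simp [holWeight, mul_add, Finset.sum_add_distrib, Finsupp.single_apply]
  have hanti : antiWeight M (s + Finsupp.single (Sum.inr j) 1 + Finsupp.single (Sum.inl i) 1) =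
      antiWeight M s + M j := by
    simp [antiWeight, mul_add, Finset.sum_add_distrib, Finsupp.single_apply]
  omega

theorem weights_of_mem_support {M : Fin n → ℕ} {d k₀ : ℕ} {P : ConjPoly n}
    (hP : IsModelPolynomial M d k₀ P) {s : Fin n ⊕ Fin n →₀ ℕ} (hs : s ∈ P.support) :
    holWeight M s + antiWeight M s = d ∧ antiWeight M s ≤ k₀ ∧ 0 < holWeight M s ∧
      0 < antiWeight M s := by
  have h1 := holWeight_add_antiWeight hP.homogeneous hs
  have h2 := hP.range _ hs
  have h3 := hP.isGreatest.1.2.1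
  omega

/-- All monomials of `P` contain both some `z_i` and some `z̄_j`, so that `P` vanishes when either
group of variables is set to zero. -/
theorem eval_dil_zero {M : Fin n → ℕ} {d k₀ : ℕ} {P : ConjPoly n}
    (hP : IsModelPolynomial M d k₀ P) {a b : ℂ} (hab : a = 0 ∨ b = 0) (x y : Fin n → ℂ) :
    MvPolynomial.eval (Sum.elim (dil M a x) (dil M b y)) P = 0 := by
  rw [eval_dil_dil]
  refine Finset.sum_eq_zero fun s hs => ?_
  obtain ⟨-, -, h1, h2⟩ := weights_of_mem_support hP hs
  rcases hab with rfl | rfl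
  · rw [zero_pow h1.ne']; ring
  · rw [zero_pow h2.ne']; ring

/-! ### A vector whose orbit consists of Levi-nondegenerate points -/

theorem flowDeriv_iterate (M : Fin n → ℕ) (p : ConjPoly n) (k m : ℕ) (φ : ℝ) (v : Fin n → ℂ) :
    flowDeriv M ((rotDeriv M)^[m] p) k φ v = flowDeriv M p (k + m) φ v := by
  rw [flowDeriv, flowDeriv, Function.iterate_add_apply]

theorem exists_orbit_leviNondegenerate {M : Fin n → ℕ} {d k₀ : ℕ} {P : ConjPoly n}
    (hP : IsModelPolynomial M d k₀ P) (hgen : GenericallyLeviNondegenerate P)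
    (hbranch : ¬ HasBranchOfDimNear (2 * n) (leviDegenerateSet P) 0) :
    ∃ v : Fin n → ℂ, evalConj P v ≠ 0 ∧
      ∀ u : ℂ, ‖u‖ = 1 → (leviMatrix P (dil M u v)).det ≠ 0 := by
  simp only [HasBranchOfDimNear] at hbranch
  push Not at hbranch
  obtain ⟨U, hU, hUreg⟩ := hbranch
  have hP0 : P ≠ 0 := by
    obtain ⟨-, -, s, hs, -⟩ := hP.isGreatest.1
    rintro rfl
    simp at hs
  have hPz : evalConj P 0 = 0 := by
    have h := eval_dil_zero hP (Or.inl rfl : (0 : ℂ) = 0 ∨ (1 : ℂ) = 0) 0 0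
    rw [← h, evalConj]
    congr 2
    funext i
    cases i <;> simp [dil]
  have hcont : Continuous fun z : Fin n → ℂ => (z, ((evalConj P z).re : ℂ)) := by
    have := continuous_evalConj P
    fun_prop
  have hUε : ∀ᶠ z in 𝓝 (0 : Fin n → ℂ), (z, ((evalConj P z).re : ℂ)) ∈ U := by
    refine hcont.continuousAt.eventually_mem ?_
    simpa [hPz] using! hU
  obtain ⟨ε, hε, hball⟩ := Metric.eventually_nhds_iff_ball.1 hUε
  obtain ⟨z₀, hz₀, hz₀P⟩ : ∃ z ∈ Metric.ball (0 : Fin n → ℂ) ε, evalConj P z ≠ 0 := by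
    by_contra! h
    exact hP0 (eq_zero_of_evalConj_eq_zero hε h)
  have hdense : Dense {z | flowDeriv M (leviDetSq P) 0 0 z ≠ 0} := by
    convert dense_leviMatrix_det_ne_zero hgen using 3 with z
    rw [Ne, flowDeriv_leviDetSq_eq_zero_iff, rot_zero]
  obtain ⟨v, hv, hvφ⟩ := exists_orbit_avoiding_zeros M (leviDetSq P)
    (O := Metric.ball 0 ε ∩ {z | evalConj P z ≠ 0})
    (Metric.isOpen_ball.inter (isOpen_ne_fun (continuous_evalConj P) continuous_const))
    ⟨z₀, hz₀, hz₀P⟩ hdense (fun v hv φ μ h0 _ h2 hiff => by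
      refine hUreg _ (hball (rot M φ v) ?_) (isRegularPointOfDim_leviDegenerateSet M P
        ((rotDeriv M)^[μ] (leviDetSq P)) ?_ ?_ ?_)
      · have := hv.1
        rw [mem_ball_zero_iff] at this ⊢
        rwa [norm_rot]
      · rwa [← flowDeriv_leviDetSq_eq_zero_iff]
      · rwa [flowDeriv_iterate, ← flowDeriv_add, zero_add, add_comm]
      · filter_upwards [hiff] with z hz
        rw [flowDeriv_iterate, zero_add, ← hz, flowDeriv_leviDetSq_eq_zero_iff, rot_zero])
  refine ⟨v, hv.2, fun u hu h => hvφ u.arg ?_⟩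
  rw [flowDeriv_leviDetSq_eq_zero_iff, rot]
  rwa [← one_mul (Complex.exp _), ← Complex.ofReal_one, ← hu, Complex.norm_mul_exp_arg_mul_I]

/-! ### The reduced Levi matrix -/

/-- The holomorphic polynomial obtained from the restriction of `p` to the boundary of the disc
`h^v` by means of `conj (1 - ζ) = -ζ⁻¹ (1 - ζ)`, cleared of the factor `ζ^{-k₀}` and of the power
of `1 - ζ`. -/
noncomputable def reducedPoly (M : Fin n → ℕ) (k₀ : ℕ) (v : Fin n → ℂ) (p : ConjPoly n) :
    Polynomial ℂ :=
  ∑ s ∈ p.support, Polynomial.C (p.coeff s * (-1) ^ antiWeight M s *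
    ((∏ i, v i ^ s (Sum.inl i)) * ∏ i, conj (v i) ^ s (Sum.inr i))) *
      Polynomial.X ^ (k₀ - antiWeight M s)

theorem pow_mul_evalConj_dil (M : Fin n → ℕ) {k₀ : ℕ} {N : ℤ} (v : Fin n → ℂ) {p : ConjPoly n}
    (hk : ∀ s ∈ p.support, antiWeight M s ≤ k₀)
    (hN : ∀ s ∈ p.support, ((holWeight M s + antiWeight M s : ℕ) : ℤ) = N)
    {ζ l : ℂ} (hl : ζ * conj l = -l) :
    ζ ^ k₀ * evalConj p (dil M l v) = l ^ N * (reducedPoly M k₀ v p).eval ζ := by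
  rw [evalConj_dil, reducedPoly, Polynomial.eval_finsetSum, Finset.mul_sum, Finset.mul_sum]
  refine Finset.sum_congr rfl fun s hs => ?_
  rw [← hN s hs, zpow_natCast, pow_add]
  have h1 : ζ ^ k₀ * conj l ^ antiWeight M s =
      (-1) ^ antiWeight M s * l ^ antiWeight M s * ζ ^ (k₀ - antiWeight M s) := by
    rw [← pow_sub_mul_pow ζ (hk s hs), mul_assoc, ← mul_pow, hl, neg_eq_neg_one_mul, mul_pow]
    ring
  simp only [Polynomial.eval_mul, Polynomial.eval_C, Polynomial.eval_pow, Polynomial.eval_X]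
  linear_combination (p.coeff s * l ^ holWeight M s *
    ((∏ i, v i ^ s (Sum.inl i)) * ∏ i, conj (v i) ^ s (Sum.inr i))) * h1

theorem mul_conj_eq_one_of_mem_sphere {ζ : ℂ} (hζ : ζ ∈ Metric.sphere (0 : ℂ) 1) :
    ζ * conj ζ = 1 := by
  rw [mem_sphere_zero_iff_norm] at hζ
  rw [Complex.mul_conj, Complex.normSq_eq_norm_sq, hζ]
  simp

theorem ne_zero_of_mem_sphere_one {ζ : ℂ} (hζ : ζ ∈ Metric.sphere (0 : ℂ) 1) : ζ ≠ 0 :=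
  left_ne_zero_of_mul_eq_one (mul_conj_eq_one_of_mem_sphere hζ)

theorem pow_mul_leviMatrix_dil {M : Fin n → ℕ} {d k₀ : ℕ} {P : ConjPoly n}
    (hP : IsModelPolynomial M d k₀ P) (v : Fin n → ℂ) (i j : Fin n) {ζ l : ℂ} (hl : ζ * conj l = -l) :
    ζ ^ k₀ * leviMatrix P (dil M l v) i j =
      l ^ ((d : ℤ) - M i - M j) * (reducedPoly M k₀ v (leviEntry P i j)).eval ζ := by
  refine pow_mul_evalConj_dil M v
    (fun s hs => (weights_of_mem_support_leviEntry hP i j hs).2) (fun s hs => ?_) hl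
  have := (weights_of_mem_support_leviEntry hP i j hs).1
  omega

theorem isReducedLeviMatrix_reducedPoly {M : Fin n → ℕ} {d k₀ : ℕ} {P : ConjPoly n}
    (hP : IsModelPolynomial M d k₀ P) (v : Fin n → ℂ) :
    IsReducedLeviMatrix M d k₀ P v
      (Matrix.of fun i j => reducedPoly M k₀ v (leviEntry P i j)) := by
  intro i j ζ hζ
  refine pow_mul_leviMatrix_dil hP v i j ?_
  have := mul_conj_eq_one_of_mem_sphere hζ
  simp only [map_sub, map_one]
  linear_combination -this

/-- At `ζ` on the unit circle the reduced Levi matrix is, up to invertible factors, the Levi matrix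
at the point of the orbit of `v` given by a square root of `-ζ`. -/
theorem reduced_det_ne_zero {M : Fin n → ℕ} {d k₀ : ℕ} {P : ConjPoly n}
    (hP : IsModelPolynomial M d k₀ P) {v : Fin n → ℂ}
    (hv : ∀ u : ℂ, ‖u‖ = 1 → (leviMatrix P (dil M u v)).det ≠ 0) {ζ : ℂ}
    (hζ : ζ ∈ Metric.sphere (0 : ℂ) 1) :
    (Matrix.of fun i j => reducedPoly M k₀ v (leviEntry P i j)).det.eval ζ ≠ 0 := by
  obtain ⟨u, hu⟩ := IsAlgClosed.exists_pow_nat_eq (-ζ) (n := 2) two_pos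
  have hζ1 := mem_sphere_zero_iff_norm.1 hζ
  have hu1 : ‖u‖ = 1 := by
    rw [← pow_eq_one_iff_of_nonneg (norm_nonneg u) two_ne_zero, ← norm_pow, hu, norm_neg, hζ1]
  have huc := mul_conj_eq_one_of_mem_sphere (mem_sphere_zero_iff_norm.2 hu1)
  have hu0 : u ≠ 0 := left_ne_zero_of_mul_eq_one huc
  have hl : ζ * conj u = -u := by
    linear_combination conj u * hu - u * huc
  have hmat : (Polynomial.evalRingHom ζ).mapMatrix
      (Matrix.of fun i j => reducedPoly M k₀ v (leviEntry P i j)) =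
      (ζ ^ k₀ * (u ^ d)⁻¹) • (Matrix.diagonal (fun i => u ^ M i) * leviMatrix P (dil M u v) *
        Matrix.diagonal fun j => u ^ M j) := by
    ext i j
    have h := pow_mul_leviMatrix_dil hP v i j hl
    rw [zpow_sub₀ hu0, zpow_sub₀ hu0, zpow_natCast, zpow_natCast, zpow_natCast] at h
    simp only [RingHom.mapMatrix_apply, Matrix.map_apply, Matrix.of_apply,
      Polynomial.coe_evalRingHom, Matrix.smul_apply, Matrix.mul_diagonal, Matrix.diagonal_mul,
      smul_eq_mul]
    field_simp at h ⊢
    linear_combination -h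
  rw [← Polynomial.coe_evalRingHom, RingHom.map_det, hmat, Matrix.det_smul, Matrix.det_mul,
    Matrix.det_mul, Matrix.det_diagonal]
  have hprod : ∏ i, u ^ M i ≠ 0 := Finset.prod_ne_zero_iff.2 fun i _ => pow_ne_zero _ hu0
  exact mul_ne_zero (pow_ne_zero _ (mul_ne_zero (pow_ne_zero _ (ne_zero_of_mem_sphere_one hζ))
    (inv_ne_zero (pow_ne_zero _ hu0)))) (mul_ne_zero (mul_ne_zero hprod (hv u hu1)) hprod)

/-! ### The attached disc -/

/-- The real part of a Laurent polynomial agrees on the unit circle with the real part of a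
polynomial, since `Re (c ζ^{-m}) = Re (conj c ζ^m)` there. -/
theorem exists_polynomial_re_eq (N : ℕ) (B : Polynomial ℂ) :
    ∃ G : Polynomial ℂ, ∀ ζ ∈ Metric.sphere (0 : ℂ) 1, ∀ b : ℂ, ζ ^ N * b = B.eval ζ →
      (G.eval ζ).re = b.re := by
  suffices h : ∃ G : Polynomial ℂ, ∀ ζ ∈ Metric.sphere (0 : ℂ) 1,
      (G.eval ζ).re = (conj ζ ^ N * B.eval ζ).re by
    obtain ⟨G, hG⟩ := h
    refine ⟨G, fun ζ hζ b hb => ?_⟩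
    rw [hG ζ hζ, ← hb, ← mul_assoc, ← mul_pow, mul_comm (conj ζ),
      mul_conj_eq_one_of_mem_sphere hζ, one_pow, one_mul]
  -- On the circle `b = conj ζ ^ N * B(ζ)`, which is additive in `B`.
  induction B using Polynomial.induction_on' with
  | add p q hp hq =>
    obtain ⟨G, hG⟩ := hp
    obtain ⟨H, hH⟩ := hq
    refine ⟨G + H, fun ζ hζ => ?_⟩
    simp only [Polynomial.eval_add, Complex.add_re, mul_add, hG ζ hζ, hH ζ hζ]
  | monomial m c =>
    rcases le_total N m with h | h
    · refine ⟨Polynomial.monomial (m - N) c, fun ζ hζ => ?_⟩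
      have h1 := mul_conj_eq_one_of_mem_sphere hζ
      congr 1
      rw [Polynomial.eval_monomial, Polynomial.eval_monomial, ← pow_sub_mul_pow ζ h]
      have : (ζ * conj ζ) ^ N = 1 := by rw [h1, one_pow]
      rw [mul_pow] at this
      linear_combination -c * ζ ^ (m - N) * this
    · refine ⟨Polynomial.monomial (N - m) (conj c), fun ζ hζ => ?_⟩
      have h1 := mul_conj_eq_one_of_mem_sphere hζ
      rw [← Complex.conj_re]
      congr 1
      rw [Polynomial.eval_monomial, Polynomial.eval_monomial, ← pow_sub_mul_pow (conj ζ) h]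
      simp only [map_mul, map_pow, Complex.conj_conj]
      have : (ζ * conj ζ) ^ m = 1 := by rw [h1, one_pow]
      rw [mul_pow] at this
      linear_combination -c * conj ζ ^ (N - m) * this

/-- The derivative of `θ ↦ G(e^{iθ})` for a polynomial `G` is of the same form. -/
theorem exists_iteratedDeriv_circleMap_eq (G : Polynomial ℂ) (k : ℕ) :
    ∃ H : Polynomial ℂ, (iteratedDeriv k fun θ : ℝ => G.eval (circleMap 0 1 θ)) =
      fun θ : ℝ => H.eval (circleMap 0 1 θ) := by
  induction k with
  | zero => exact ⟨G, by simp⟩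
  | succ k ih =>
    obtain ⟨H, hH⟩ := ih
    refine ⟨H.derivative * (Polynomial.X * Polynomial.C Complex.I), ?_⟩
    rw [iteratedDeriv_succ, hH]
    funext θ
    have := ((H.hasDerivAt (circleMap 0 1 θ)).comp_of_eq θ (hasDerivAt_circleMap 0 1 θ) rfl).deriv
    simpa [Function.comp_def, mul_comm Complex.I] using this

theorem exists_holderWith_polynomial_circleMap (H : Polynomial ℂ) {α : ℝ≥0} (hα : α ≤ 1) :
    ∃ C, HolderWith C α fun θ : ℝ => H.eval (circleMap 0 1 θ) := by
  obtain ⟨K, hK⟩ : ∃ K, LipschitzOnWith K (fun z => H.eval z) (Metric.closedBall (0 : ℂ) 1) :=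
    ((H.contDiff_aeval (𝕜 := ℂ) 1).restrict_scalars ℝ).contDiffOn.exists_lipschitzOnWith one_ne_zero
      (convex_closedBall 0 1) (isCompact_closedBall 0 1)
  have hmaps (θ : ℝ) : circleMap 0 1 θ ∈ Metric.closedBall (0 : ℂ) 1 :=
    Metric.sphere_subset_closedBall (circleMap_mem_sphere 0 zero_le_one θ)
  have hlip : LipschitzWith (K * Real.nnabs 1) fun θ : ℝ => H.eval (circleMap 0 1 θ) := by
    rw [← lipschitzOnWith_univ]
    exact hK.comp (lipschitzWith_circleMap 0 1).lipschitzOnWith fun θ _ => hmaps θ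
  have hbdd : ∀ x y : ℝ, edist (H.eval (circleMap 0 1 x)) (H.eval (circleMap 0 1 y)) ≤
      ((K * 2 : ℝ≥0) : ENNReal) := by
    intro x y
    refine (hK (hmaps x) (hmaps y)).trans ?_
    rw [ENNReal.coe_mul]
    gcongr
    rw [edist_nndist]
    norm_cast
    rw [← NNReal.coe_le_coe, coe_nndist]
    have h1 := mem_closedBall_zero_iff.1 (hmaps x)
    have h2 := mem_closedBall_zero_iff.1 (hmaps y)
    rw [dist_eq_norm]
    calc _ ≤ _ := norm_sub_le _ _
      _ ≤ _ := by push_cast; linarith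
  have h0 : HolderWith (K * 2) 0 fun θ : ℝ => H.eval (circleMap 0 1 θ) := fun x y => by
    simpa using hbdd x y
  have := (holderWith_one.2 hlip).interpolate h0 (add_tsub_cancel_of_le hα)
  rw [one_mul, zero_mul, add_zero] at this
  exact ⟨_, this⟩

theorem isHolderDisc_polynomial (G : Polynomial ℂ) (k : ℕ) {α : ℝ≥0} (hα : α ≤ 1) :
    IsHolderDisc k α fun ζ => G.eval ζ := by
  refine ⟨(Polynomial.differentiable G).diffContOnCl, ?_, ?_⟩
  · exact ((G.contDiff_aeval (𝕜 := ℂ) (k : ℕ∞)).restrict_scalars ℝ).comp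
      (contDiff_circleMap 0 1)
  · obtain ⟨H, hH⟩ := exists_iteratedDeriv_circleMap_eq G k
    rw [hH]
    exact exists_holderWith_polynomial_circleMap H hα

/-- A polynomial `G` whose real part agrees with `P ∘ h^v` on the unit disc forces `P(v) = 0`:
polarization gives `G(a) + Ḡ(b) = 2 P((1 - a)^{m_i} v_i, (1 - b)^{m_i} v̄_i)` for independent `a`
and `b`, where `Ḡ` has the conjugate coefficients. The right-hand side vanishes for `a = 1` and for
`b = 1`, hence identically. -/
theorem evalConj_eq_zero_of_re_eq_on_ball {M : Fin n → ℕ} {d k₀ : ℕ} {P : ConjPoly n}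
    (hP : IsModelPolynomial M d k₀ P) (v : Fin n → ℂ) (G : Polynomial ℂ)
    (h : ∀ ζ ∈ Metric.ball (0 : ℂ) 1, (G.eval ζ).re = (evalConj P (discH M v ζ)).re) :
    evalConj P v = 0 := by
  -- The polynomial `2 (Re G - P ∘ h^v)` in one variable `ζ` and its conjugate.
  let R : ConjPoly 1 :=
    Polynomial.aeval (MvPolynomial.X (Sum.inl 0)) G +
      Polynomial.aeval (MvPolynomial.X (Sum.inr 0)) (G.map (starRingEnd ℂ)) -
      2 * MvPolynomial.bind₁ (Sum.elim
        (fun i => (1 - MvPolynomial.X (Sum.inl 0)) ^ M i * MvPolynomial.C (v i))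
        (fun i => (1 - MvPolynomial.X (Sum.inr 0)) ^ M i * MvPolynomial.C (conj (v i)))) P
  have hR (x : Fin 1 ⊕ Fin 1 → ℂ) : MvPolynomial.eval x R =
      G.eval (x (Sum.inl 0)) + (G.map (starRingEnd ℂ)).eval (x (Sum.inr 0)) -
        2 * MvPolynomial.eval (Sum.elim (dil M (1 - x (Sum.inl 0)) v)
          (dil M (1 - x (Sum.inr 0)) fun i => conj (v i))) P := by
    simp only [R, ← MvPolynomial.aeval_eq_eval, map_add, map_sub, map_mul, map_ofNat,
      MvPolynomial.aeval_bind₁, ← Polynomial.aeval_algHom_apply, MvPolynomial.aeval_X,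
      Polynomial.coe_aeval_eq_eval]
    congr 4
    funext i
    cases i <;> simp [dil]
  have hR0 : R = 0 := by
    refine eq_zero_of_evalConj_eq_zero one_pos fun z hz => ?_
    have hz0 : z 0 ∈ Metric.ball (0 : ℂ) 1 := by
      rw [mem_ball_zero_iff] at hz ⊢
      exact (norm_le_pi_norm z 0).trans_lt hz
    have hPz : MvPolynomial.eval (Sum.elim (dil M (1 - z 0) v)
        (dil M (1 - conj (z 0)) fun i => conj (v i))) P = evalConj P (discH M v (z 0)) := by
      rw [evalConj]
      congr 2
      funext i
      cases i <;> simp [dil, discH]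
    rw [evalConj, hR, Sum.elim_inl, Sum.elim_inr, hPz, Polynomial.eval_map,
      Polynomial.eval₂_at_apply]
    have hre := h (z 0) hz0
    have him := hP.real_valued (discH M v (z 0))
    apply Complex.ext
    · simp [hre]
      ring
    · simp [him]
  have key (a b : ℂ) : G.eval a + (G.map (starRingEnd ℂ)).eval b =
      2 * MvPolynomial.eval (Sum.elim (dil M (1 - a) v)
        (dil M (1 - b) fun i => conj (v i))) P := by
    have := hR (Sum.elim (fun _ => a) fun _ => b)
    rw [hR0, map_zero] at this
    exact (sub_eq_zero.1 this.symm)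
  have h00 := key 0 0
  have h01 := key 0 1
  have h10 := key 1 0
  have h11 := key 1 1
  rw [eval_dil_zero hP (Or.inr (sub_self 1))] at h01 h11
  rw [eval_dil_zero hP (Or.inl (sub_self 1))] at h10
  rw [sub_zero, dil_one, dil_one] at h00
  rw [evalConj]
  linear_combination (h01 + h10 - h00 - h11) / 2

theorem exists_attached_disc {M : Fin n → ℕ} {d k₀ : ℕ} {P : ConjPoly n}
    (hP : IsModelPolynomial M d k₀ P) {v : Fin n → ℂ} (hv : evalConj P v ≠ 0) :
    ∃ G : Polynomial ℂ,
      (fun ζ => (discH M v ζ, G.eval ζ)) '' Metric.sphere 0 1 ⊆ modelHypersurface P ∧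
      ¬ (fun ζ => (discH M v ζ, G.eval ζ)) '' Metric.ball 0 1 ⊆ modelHypersurface P := by
  obtain ⟨G, hG⟩ := exists_polynomial_re_eq k₀
    ((1 - Polynomial.X) ^ d * reducedPoly M k₀ v P)
  refine ⟨G, ?_, fun hsub => hv (evalConj_eq_zero_of_re_eq_on_ball hP v G fun ζ hζ => ?_)⟩
  · rintro _ ⟨ζ, hζ, rfl⟩
    have hl : ζ * conj (1 - ζ) = -(1 - ζ) := by
      have := mul_conj_eq_one_of_mem_sphere hζ
      simp only [map_sub, map_one]
      linear_combination -this
    have hb := pow_mul_evalConj_dil M v (N := d)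
      (fun s hs => (weights_of_mem_support hP hs).2.1)
      (fun s hs => by rw [(weights_of_mem_support hP hs).1]) hl
    have := hG ζ hζ (evalConj P (discH M v ζ)) (by
      simpa using! hb)
    simp [modelHypersurface, this]
  · have : -(G.eval ζ).re + (evalConj P (discH M v ζ)).re = 0 := hsub ⟨ζ, hζ, rfl⟩
    linarith

end LeviModel

theorem mainTheorem7 {n : ℕ} (M : Fin n → ℕ) (d k₀ : ℕ) (P : LeviModel.ConjPoly n)
    (hP : LeviModel.IsModelPolynomial M d k₀ P)
    (hgen : LeviModel.GenericallyLeviNondegenerate P)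
    (hbranch : ¬ LeviModel.HasBranchOfDimNear (2 * n) (LeviModel.leviDegenerateSet P) 0) :
    ∃ v : Fin n → ℂ, ∀ (k : ℕ) (α : ℝ≥0), 0 < α → α < 1 →
      LeviModel.IsAdmissible k α M d k₀ P v := by
  obtain ⟨v, hv, hdet⟩ := LeviModel.exists_orbit_leviNondegenerate hP hgen hbranch
  obtain ⟨G, hG, hG'⟩ := LeviModel.exists_attached_disc hP hv
  exact ⟨v, fun k α _ hα => ⟨⟨fun ζ => G.eval ζ,
    LeviModel.isHolderDisc_polynomial G k hα.le, hG, hG'⟩, _,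
    LeviModel.isReducedLeviMatrix_reducedPoly hP v, fun ζ hζ =>
      LeviModel.reduced_det_ne_zero hP hdet hζ⟩⟩
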